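/- Let $A$ be an $f$-algebra, that is, a real Riesz space with an associative bilinear multiplication (not necessarily unital) such that $ab\ge 0$ whenever $a,b\ge 0$, and such that $a\wedge b=0$, $c\ge 0$ imply $(ca)\wedge b=(ac)\wedge b=0$. Let $A^{\sim}$ be the order dual of $A$ (the Riesz space of order bounded linear functionals on $A$) and assume that $A^{\sim}$ separates the points of $A$. Let $(A^{\sim})^{\sim}_n$ be the space of order continuous functionals in the order dual of $A^{\sim}$. For $f\in A^{\sim}$, $a\in A$ and $F\in (A^{\sim})^{\sim}_n$ define $f\cdot a\in A^{\sim}$ and $F\cdot f\in A^{\sim}$ by $$(f\cdot a)(b)=f(ab)\quad(b\in A),\qquad (F\cdot f)(a)=F(f\cdot a)\quad(a\in A),$$ and put $R(f)=\{F\cdot f: F\in (A^{\sim})^{\sim}_n\}$. An order bounded linear operator $T:A^{\sim}\to A^{\sim}$ is called $f$-linear with respect to $(A^{\sim})^{\sim}_n$ if $T(G\cdot f)=G\cdot T(f)$ for all $f\in A^{\sim}$ and $G\in (A^{\sim})^{\sim}_n$; it is called an $f$-orthomorphism on $A^{\sim}$ if $R(Tf)\subseteq R(f)$ for every $f\in A^{\sim}$.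 Theorem. Every order bounded operator on $A^{\sim}$ that is $f$-linear with respect to $(A^{\sim})^{\sim}_n$ is an $f$-orthomorphism, i.e. $$L_{b}(A^{\sim},A^{\sim};(A^{\sim})^{\sim}_{n})\subseteq \mathrm{Orth}(A^{\sim},A^{\sim};(A^{\sim})^{\sim}_{n}).$$ -/

import Mathlib

open Filter Topology

noncomputable section

/-! Throughout, a (real) Riesz space is a type `E` with
`[AddCommGroup E] [Module ℝ E] [Lattice E] [IsOrderedAddMonoid E] [IsOrderedModule ℝ E]`. -/

/-- A linear map between ordered vector spaces is order bounded if it maps order bounded sets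
to order bounded sets. -/
def IsOrderBoundedMap {E F : Type*} [AddCommGroup E] [Module ℝ E] [Preorder E]
    [AddCommGroup F] [Module ℝ F] [Preorder F] (T : E →ₗ[ℝ] F) : Prop :=
  ∀ s : Set E, BddBelow s → BddAbove s → BddBelow (T '' s) ∧ BddAbove (T '' s)

/-- The order bounded linear functionals, as a subspace of the algebraic dual. -/
def orderBoundedFunctionals (E : Type*) [AddCommGroup E] [Module ℝ E] [Preorder E] :
    Submodule ℝ (E →ₗ[ℝ] ℝ) where
  carrier := {f | IsOrderBoundedMap f}
  zero_mem' := by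
    intro s _ _
    constructor
    · exact ⟨0, by rintro _ ⟨x, _, rfl⟩; simp⟩
    · exact ⟨0, by rintro _ ⟨x, _, rfl⟩; simp⟩
  add_mem' := by
    intro f g hf hg s h1 h2
    obtain ⟨⟨a, ha⟩, b, hb⟩ := hf s h1 h2
    obtain ⟨⟨c, hc⟩, d, hd⟩ := hg s h1 h2
    constructor
    · refine ⟨a + c, ?_⟩
      rintro _ ⟨x, hx, rfl⟩
      exact add_le_add (ha ⟨x, hx, rfl⟩) (hc ⟨x, hx, rfl⟩)
    · refine ⟨b + d, ?_⟩
      rintro _ ⟨x, hx, rfl⟩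
      exact add_le_add (hb ⟨x, hx, rfl⟩) (hd ⟨x, hx, rfl⟩)
  smul_mem' := by
    intro t f hf s h1 h2
    obtain ⟨⟨a, ha⟩, b, hb⟩ := hf s h1 h2
    rcases le_total 0 t with ht | ht
    · constructor
      · refine ⟨t * a, ?_⟩
        rintro _ ⟨x, hx, rfl⟩
        exact mul_le_mul_of_nonneg_left (ha ⟨x, hx, rfl⟩) ht
      · refine ⟨t * b, ?_⟩
        rintro _ ⟨x, hx, rfl⟩
        exact mul_le_mul_of_nonneg_left (hb ⟨x, hx, rfl⟩) ht
    · constructor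
      · refine ⟨t * b, ?_⟩
        rintro _ ⟨x, hx, rfl⟩
        exact mul_le_mul_of_nonpos_left (hb ⟨x, hx, rfl⟩) ht
      · refine ⟨t * a, ?_⟩
        rintro _ ⟨x, hx, rfl⟩
        exact mul_le_mul_of_nonpos_left (ha ⟨x, hx, rfl⟩) ht

/-- The order dual `E^~` of `E`: the space of order bounded linear functionals on `E`. -/
def RieszDual (E : Type*) [AddCommGroup E] [Module ℝ E] [Preorder E] : Type _ :=
  ↥(orderBoundedFunctionals E)

namespace RieszDual

section Basic

variable {E : Type*} [AddCommGroup E] [Module ℝ E] [Preorder E]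

instance : AddCommGroup (RieszDual E) := inferInstanceAs (AddCommGroup ↥(orderBoundedFunctionals E))

instance : Module ℝ (RieszDual E) := inferInstanceAs (Module ℝ ↥(orderBoundedFunctionals E))

/-- The underlying linear functional of an element of the order dual. -/
def toLin (f : RieszDual E) : E →ₗ[ℝ] ℝ := f.1

/-- An order bounded linear functional, as an element of the order dual. -/
def ofLin (f : E →ₗ[ℝ] ℝ) (hf : IsOrderBoundedMap f) : RieszDual E := ⟨f, hf⟩

instance : CoeFun (RieszDual E) (fun _ => E → ℝ) := ⟨fun f => f.toLin⟩

theorem isOrderBoundedMap (f : RieszDual E) : IsOrderBoundedMap f.toLin := f.2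

@[simp] theorem ofLin_apply (f : E →ₗ[ℝ] ℝ) (hf : IsOrderBoundedMap f) (x : E) :
    (ofLin f hf) x = f x := rfl

@[simp] theorem toLin_ofLin (f : E →ₗ[ℝ] ℝ) (hf : IsOrderBoundedMap f) :
    (ofLin f hf).toLin = f := rfl

@[simp] theorem add_apply (f g : RieszDual E) (x : E) : (f + g) x = f x + g x := rfl

@[simp] theorem neg_apply (f : RieszDual E) (x : E) : (-f) x = -f x := rfl

@[simp] theorem sub_apply (f g : RieszDual E) (x : E) : (f - g) x = f x - g x := rfl

@[simp] theorem zero_apply (x : E) : (0 : RieszDual E) x = 0 := rfl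

@[simp] theorem smul_apply (t : ℝ) (f : RieszDual E) (x : E) : (t • f) x = t * f x := rfl

theorem ext {f g : RieszDual E} (h : ∀ x, f x = g x) : f = g :=
  Subtype.ext (LinearMap.ext h)

end Basic

section Order

variable {E : Type*} [AddCommGroup E] [Module ℝ E] [Lattice E] [IsOrderedAddMonoid E]

/-- The order of `E^~`: `f ≤ g` iff `f x ≤ g x` for all `x ≥ 0`. -/
instance : PartialOrder (RieszDual E) where
  le f g := ∀ x : E, 0 ≤ x → f x ≤ g x
  le_refl f x _ := le_refl _
  le_trans f g h h1 h2 x hx := (h1 x hx).trans (h2 x hx)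
  le_antisymm f g h1 h2 := by
    have key : ∀ x : E, 0 ≤ x → f x = g x := fun x hx => le_antisymm (h1 x hx) (h2 x hx)
    apply RieszDual.ext
    intro x
    rw [← posPart_sub_negPart x, map_sub, map_sub, key _ (posPart_nonneg x),
      key _ (negPart_nonneg x)]

theorem le_def {f g : RieszDual E} : f ≤ g ↔ ∀ x : E, 0 ≤ x → f x ≤ g x := Iff.rfl

instance : IsOrderedAddMonoid (RieszDual E) where
  add_le_add_left f g h k x hx := by
    simpa using h x hx

instance : IsOrderedModule ℝ (RieszDual E) where
  smul_le_smul_of_nonneg_left _t ht _f _g h x hx := mul_le_mul_of_nonneg_left (h x hx) ht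
  smul_le_smul_of_nonneg_right _f hf _s _t h x hx := mul_le_mul_of_nonneg_right h (hf x hx)

end Order

section RieszKantorovich

variable {E : Type*} [AddCommGroup E] [Module ℝ E] [Lattice E] [IsOrderedAddMonoid E]
  [IsOrderedModule ℝ E]

/-- The Riesz–Kantorovich formula `f⁺(x) = sup {f y : 0 ≤ y ≤ x}`, for `x ≥ 0`. -/
def posAux (f : RieszDual E) (x : E) : ℝ := sSup (f '' Set.Icc 0 x)

theorem bddAbove_posAux (f : RieszDual E) (x : E) : BddAbove (f '' Set.Icc 0 x) :=
  (f.isOrderBoundedMap _ bddBelow_Icc bddAbove_Icc).2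

theorem le_posAux (f : RieszDual E) {x y : E} (h0 : 0 ≤ y) (h1 : y ≤ x) : f y ≤ posAux f x :=
  le_csSup (bddAbove_posAux f x) ⟨y, ⟨h0, h1⟩, rfl⟩

theorem posAux_le (f : RieszDual E) {x : E} (hx : 0 ≤ x) {c : ℝ}
    (h : ∀ y, 0 ≤ y → y ≤ x → f y ≤ c) : posAux f x ≤ c := by
  refine csSup_le ⟨f 0, 0, ⟨le_refl _, hx⟩, rfl⟩ ?_
  rintro _ ⟨y, hy, rfl⟩
  exact h y hy.1 hy.2

theorem posAux_nonneg (f : RieszDual E) {x : E} (hx : 0 ≤ x) : 0 ≤ posAux f x := by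
  have := le_posAux f (le_refl (0 : E)) hx
  simpa using this

theorem posAux_add (f : RieszDual E) {x y : E} (hx : 0 ≤ x) (hy : 0 ≤ y) :
    posAux f (x + y) = posAux f x + posAux f y := by
  apply le_antisymm
  · refine posAux_le f (add_nonneg hx hy) fun w h0 h1 => ?_
    have e : f w = f (w ⊓ x) + f (w - w ⊓ x) := by rw [← map_add]; congr 1; abel
    rw [e]
    refine add_le_add (le_posAux f (le_inf h0 hx) inf_le_right)
      (le_posAux f (sub_nonneg.2 inf_le_left) ?_)
    rw [sub_le_iff_le_add, add_comm, inf_add]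
    exact le_inf (le_add_of_nonneg_right hy) h1
  · rw [← le_sub_iff_add_le]
    refine posAux_le f hx fun u hu0 hu1 => ?_
    rw [le_sub_comm]
    refine posAux_le f hy fun v hv0 hv1 => ?_
    rw [le_sub_iff_add_le, ← map_add]
    exact le_posAux f (add_nonneg hv0 hu0) (by rw [add_comm]; exact add_le_add hu1 hv1)

theorem posAux_smul_le (f : RieszDual E) {x : E} (hx : 0 ≤ x) {t : ℝ} (ht : 0 < t) :
    t * posAux f x ≤ posAux f (t • x) := by
  rw [← le_div_iff₀' ht]
  refine posAux_le f hx fun y h0 h1 => ?_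
  rw [le_div_iff₀' ht]
  have := le_posAux f (smul_nonneg ht.le h0) (smul_le_smul_of_nonneg_left h1 ht.le)
  simpa using this

theorem posAux_smul (f : RieszDual E) {x : E} (hx : 0 ≤ x) {t : ℝ} (ht : 0 ≤ t) :
    posAux f (t • x) = t * posAux f x := by
  rcases ht.eq_or_lt with rfl | ht
  · have := posAux_add f (le_refl (0 : E)) (le_refl (0 : E))
    simp only [add_zero] at this
    simp only [zero_smul, zero_mul]
    linarith
  · refine le_antisymm ?_ (posAux_smul_le f hx ht)
    have := posAux_smul_le f (smul_nonneg ht.le hx) (inv_pos.2 ht)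
    rw [smul_smul, inv_mul_cancel₀ ht.ne', one_smul] at this
    rwa [inv_mul_le_iff₀ ht] at this

theorem posAux_sub_eq (f : RieszDual E) {a b c d : E} (ha : 0 ≤ a) (hb : 0 ≤ b) (hc : 0 ≤ c)
    (hd : 0 ≤ d) (h : a - b = c - d) :
    posAux f a - posAux f b = posAux f c - posAux f d := by
  have e : a + d = c + b := by rwa [sub_eq_sub_iff_add_eq_add] at h
  have := posAux_add f ha hd
  rw [e, posAux_add f hc hb] at this
  linarith

/-- The linear extension of `posAux f` from the positive cone. -/
def posLin (f : RieszDual E) : E →ₗ[ℝ] ℝ where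
  toFun x := posAux f x⁺ - posAux f x⁻
  map_add' x y := by
    have h := posAux_sub_eq f (posPart_nonneg (x + y)) (negPart_nonneg (x + y))
      (add_nonneg (posPart_nonneg x) (posPart_nonneg y))
      (add_nonneg (negPart_nonneg x) (negPart_nonneg y))
      (by rw [posPart_sub_negPart, add_sub_add_comm, posPart_sub_negPart, posPart_sub_negPart])
    rw [h, posAux_add f (posPart_nonneg x) (posPart_nonneg y),
      posAux_add f (negPart_nonneg x) (negPart_nonneg y)]
    ring
  map_smul' t x := by
    simp only [RingHom.id_apply, smul_eq_mul]
    rcases le_total 0 t with ht | ht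
    · rw [posAux_sub_eq f (posPart_nonneg (t • x)) (negPart_nonneg (t • x))
        (smul_nonneg ht (posPart_nonneg x)) (smul_nonneg ht (negPart_nonneg x))
        (by rw [posPart_sub_negPart, ← smul_sub, posPart_sub_negPart]),
        posAux_smul f (posPart_nonneg x) ht, posAux_smul f (negPart_nonneg x) ht]
      ring
    · have ht' : 0 ≤ -t := neg_nonneg.2 ht
      rw [posAux_sub_eq f (posPart_nonneg (t • x)) (negPart_nonneg (t • x))
        (smul_nonneg ht' (negPart_nonneg x)) (smul_nonneg ht' (posPart_nonneg x))
        (by rw [posPart_sub_negPart, ← smul_sub, ← neg_sub, posPart_sub_negPart, smul_neg,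
              neg_smul, neg_neg]),
        posAux_smul f (posPart_nonneg x) ht', posAux_smul f (negPart_nonneg x) ht']
      ring

theorem posLin_apply (f : RieszDual E) {x : E} (hx : 0 ≤ x) : posLin f x = posAux f x := by
  have h0 : posAux f 0 = 0 := by
    have := posAux_smul f (le_refl (0 : E)) (le_refl (0 : ℝ))
    simpa using this
  change posAux f x⁺ - posAux f x⁻ = _
  rw [posPart_of_nonneg hx, negPart_of_nonneg hx, h0, sub_zero]

theorem isOrderBoundedMap_of_nonneg {F : Type*} [AddCommGroup F] [Module ℝ F] [Preorder F]
    [AddLeftMono F] (T : E →ₗ[ℝ] F) (hT : ∀ x, 0 ≤ x → 0 ≤ T x) : IsOrderBoundedMap T := by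
  have mono : ∀ x y, x ≤ y → T x ≤ T y := by
    intro x y h
    have h2 := add_le_add_right (hT (y - x) (sub_nonneg.2 h)) (T x)
    rwa [add_zero, ← map_add, add_sub_cancel] at h2
  rintro s ⟨l, hl⟩ ⟨u, hu⟩
  constructor
  · refine ⟨T l, ?_⟩
    rintro _ ⟨x, hx, rfl⟩
    exact mono _ _ (hl hx)
  · refine ⟨T u, ?_⟩
    rintro _ ⟨x, hx, rfl⟩
    exact mono _ _ (hu hx)

/-- `f ⊔ 0` in the order dual. -/
def pos (f : RieszDual E) : RieszDual E :=
  ofLin (posLin f) (isOrderBoundedMap_of_nonneg _ fun x hx => by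
    rw [posLin_apply f hx]; exact posAux_nonneg f hx)

theorem pos_apply (f : RieszDual E) {x : E} (hx : 0 ≤ x) : pos f x = posAux f x :=
  posLin_apply f hx

theorem pos_nonneg (f : RieszDual E) : 0 ≤ pos f := fun x hx => by
  rw [pos_apply f hx]; exact posAux_nonneg f hx

theorem le_pos (f : RieszDual E) : f ≤ pos f := fun x hx => by
  rw [pos_apply f hx]; exact le_posAux f hx (le_refl x)

theorem pos_le {f g : RieszDual E} (hg : 0 ≤ g) (h : f ≤ g) : pos f ≤ g := fun x hx => by
  rw [pos_apply f hx]
  refine posAux_le f hx fun y h0 h1 => (h y h0).trans ?_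
  have := hg (x - y) (sub_nonneg.2 h1)
  rw [map_sub] at this
  simpa using this

/-- The order dual of a Riesz space is a Riesz space. -/
instance : Lattice (RieszDual E) where
  sup f g := f + pos (g - f)
  inf f g := f - pos (f - g)
  le_sup_left f g := le_add_of_nonneg_right (pos_nonneg _)
  le_sup_right f g := by
    have := add_le_add_right (le_pos (g - f)) f
    rwa [add_sub_cancel] at this
  sup_le f g h h1 h2 := by
    have := add_le_add_right (pos_le (sub_nonneg.2 h1) (sub_le_sub_right h2 f)) f
    rwa [add_sub_cancel] at this
  inf_le_left f g := sub_le_self _ (pos_nonneg _)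
  inf_le_right f g := by
    have := sub_le_sub_left (le_pos (f - g)) f
    rwa [sub_sub_cancel] at this
  le_inf h f g h1 h2 := by
    have := sub_le_sub_left (pos_le (sub_nonneg.2 h1) (sub_le_sub_left h2 f)) f
    rwa [sub_sub_cancel] at this

end RieszKantorovich

end RieszDual

/-- A net `x` in a Riesz space converges in order to `0`: there is a net `y ↓ 0` over the same
index set with `|x i| ≤ y i` for all `i`. -/
def OrderTendstoZero {E ι : Type*} [AddCommGroup E] [Lattice E] [Preorder ι] (x : ι → E) : Prop :=
  ∃ y : ι → E, Antitone y ∧ IsGLB (Set.range y) 0 ∧ ∀ i, |x i| ≤ y i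

/-- `E^~_n`: the order continuous elements of the order dual, i.e. those which map nets that
converge in order to `0` to nets that converge to `0`. -/
def orderContinuousDual.{u} (E : Type u) [AddCommGroup E] [Module ℝ E] [Lattice E] :
    Submodule ℝ (RieszDual E) where
  carrier := {F | ∀ (ι : Type u) [Preorder ι] [IsDirected ι (· ≤ ·)] [Nonempty ι] (x : ι → E),
    OrderTendstoZero x → Tendsto (fun i => F (x i)) atTop (𝓝 0)}
  zero_mem' := by
    intro ι _ _ _ x _
    simp
  add_mem' := by
    intro F G hF hG ι _ _ _ x hx
    simpa using (hF ι x hx).add (hG ι x hx)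
  smul_mem' := by
    intro t F hF ι _ _ _ x hx
    simpa using (hF ι x hx).const_mul t

/-- `f`-algebras: Riesz spaces with an associative multiplication (not necessarily unital) such
that products of positive elements are positive and `a ⊓ b = 0`, `0 ≤ c` imply
`(c * a) ⊓ b = 0` and `(a * c) ⊓ b = 0`. -/
class IsFAlgebra (A : Type*) [NonUnitalRing A] [Module ℝ A] [IsScalarTower ℝ A A]
    [SMulCommClass ℝ A A] [Lattice A] [IsOrderedAddMonoid A] [IsOrderedModule ℝ A] : Prop where
  mul_nonneg : ∀ a b : A, 0 ≤ a → 0 ≤ b → 0 ≤ a * b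
  mul_left_inf : ∀ a b c : A, a ⊓ b = 0 → 0 ≤ c → (c * a) ⊓ b = 0
  mul_right_inf : ∀ a b c : A, a ⊓ b = 0 → 0 ≤ c → (a * c) ⊓ b = 0

/-- The order dual of `E` separates the points of `E`. -/
def HasSeparatingOrderDual (E : Type*) [AddCommGroup E] [Module ℝ E] [Preorder E] : Prop :=
  ∀ x : E, (∀ f : RieszDual E, f x = 0) → x = 0

section FAlgebra

theorem IsOrderBoundedMap.comp {E F G : Type*} [AddCommGroup E] [Module ℝ E] [Preorder E]
    [AddCommGroup F] [Module ℝ F] [Preorder F] [AddCommGroup G] [Module ℝ G] [Preorder G]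
    {S : F →ₗ[ℝ] G} {T : E →ₗ[ℝ] F} (hS : IsOrderBoundedMap S) (hT : IsOrderBoundedMap T) :
    IsOrderBoundedMap (S ∘ₗ T) := by
  intro s h1 h2
  obtain ⟨h3, h4⟩ := hT s h1 h2
  have := hS _ h3 h4
  rwa [← Set.image_comp] at this

theorem IsOrderBoundedMap.sub {E F : Type*} [AddCommGroup E] [Module ℝ E] [Preorder E]
    [AddCommGroup F] [Module ℝ F] [Lattice F] [IsOrderedAddMonoid F]
    {S T : E →ₗ[ℝ] F} (hS : IsOrderBoundedMap S) (hT : IsOrderBoundedMap T) :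
    IsOrderBoundedMap (S - T) := by
  intro s h1 h2
  obtain ⟨⟨a, ha⟩, b, hb⟩ := hS s h1 h2
  obtain ⟨⟨c, hc⟩, d, hd⟩ := hT s h1 h2
  constructor
  · refine ⟨a - d, ?_⟩
    rintro _ ⟨x, hx, rfl⟩
    exact sub_le_sub (ha ⟨x, hx, rfl⟩) (hd ⟨x, hx, rfl⟩)
  · refine ⟨b - c, ?_⟩
    rintro _ ⟨x, hx, rfl⟩
    exact sub_le_sub (hb ⟨x, hx, rfl⟩) (hc ⟨x, hx, rfl⟩)

variable {A : Type*} [NonUnitalRing A] [Module ℝ A] [IsScalarTower ℝ A A]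
  [SMulCommClass ℝ A A] [Lattice A] [IsOrderedAddMonoid A] [IsOrderedModule ℝ A] [IsFAlgebra A]

theorem isOrderBoundedMap_mulLeft (a : A) : IsOrderBoundedMap (LinearMap.mulLeft ℝ a) := by
  have e : LinearMap.mulLeft ℝ a = LinearMap.mulLeft ℝ a⁺ - LinearMap.mulLeft ℝ a⁻ := by
    ext x
    simp [← sub_mul]
  rw [e]
  exact (RieszDual.isOrderBoundedMap_of_nonneg _ fun x hx =>
    IsFAlgebra.mul_nonneg _ _ (posPart_nonneg a) hx).sub
    (RieszDual.isOrderBoundedMap_of_nonneg _ fun x hx =>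
    IsFAlgebra.mul_nonneg _ _ (negPart_nonneg a) hx)

/-- `f · a`, the element of `A^~` given by `(f · a) b = f (a * b)`. -/
def dualMul (f : RieszDual A) (a : A) : RieszDual A :=
  RieszDual.ofLin (f.toLin ∘ₗ LinearMap.mulLeft ℝ a)
    (f.isOrderBoundedMap.comp (isOrderBoundedMap_mulLeft a))

@[simp] theorem dualMul_apply (f : RieszDual A) (a b : A) : dualMul f a b = f (a * b) := rfl

/-- The linear map `a ↦ f · a` from `A` to `A^~`. -/
def dualMulLin (f : RieszDual A) : A →ₗ[ℝ] RieszDual A where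
  toFun a := dualMul f a
  map_add' a b := RieszDual.ext fun x => by simp [add_mul]
  map_smul' t a := RieszDual.ext fun x => by simp [smul_mul_assoc]

theorem isOrderBoundedMap_dualMulLin (f : RieszDual A) : IsOrderBoundedMap (dualMulLin f) := by
  have nn : ∀ g : RieszDual A, 0 ≤ g → IsOrderBoundedMap (dualMulLin g) := fun g hg =>
    RieszDual.isOrderBoundedMap_of_nonneg _ fun a ha x hx =>
      hg (a * x) (IsFAlgebra.mul_nonneg _ _ ha hx)
  have e : dualMulLin f = dualMulLin f⁺ - dualMulLin f⁻ := by
    refine LinearMap.ext fun a => RieszDual.ext fun x => ?_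
    change f (a * x) = f⁺ (a * x) - f⁻ (a * x)
    rw [← RieszDual.sub_apply, posPart_sub_negPart]
  rw [e]
  exact (nn _ (posPart_nonneg f)).sub (nn _ (negPart_nonneg f))

/-- `F · f`, the element of `A^~` given by `(F · f) a = F (f · a)`. -/
def bidualMul (F : RieszDual (RieszDual A)) (f : RieszDual A) : RieszDual A :=
  RieszDual.ofLin (F.toLin ∘ₗ dualMulLin f)
    (F.isOrderBoundedMap.comp (isOrderBoundedMap_dualMulLin f))

@[simp] theorem bidualMul_apply (F : RieszDual (RieszDual A)) (f : RieszDual A) (a : A) :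
    bidualMul F f a = F (dualMul f a) := rfl

/-- `R(f) = {F · f : F ∈ (A^~)^~_n}`. -/
def dualRange (f : RieszDual A) : Set (RieszDual A) :=
  {g | ∃ F ∈ orderContinuousDual (RieszDual A), g = bidualMul F f}

variable (A)

/-- `L_b(A^~, A^~; (A^~)^~_n)`: the order bounded operators `T` on `A^~` that are `f`-linear with
respect to `(A^~)^~_n`, i.e. `T (G · f) = G · T f` for all `f ∈ A^~` and `G ∈ (A^~)^~_n`. -/
def fLinearOperators : Set (RieszDual A →ₗ[ℝ] RieszDual A) :=
  {T | IsOrderBoundedMap T ∧ ∀ f : RieszDual A, ∀ G ∈ orderContinuousDual (RieszDual A),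
    T (bidualMul G f) = bidualMul G (T f)}

/-- `Orth(A^~, A^~; (A^~)^~_n)`: the `f`-orthomorphisms on `A^~`, i.e. the order bounded operators
`T` on `A^~` such that `R(T f) ⊆ R(f)` for all `f ∈ A^~`. -/
def fOrthomorphisms : Set (RieszDual A →ₗ[ℝ] RieszDual A) :=
  {T | IsOrderBoundedMap T ∧ ∀ f : RieszDual A, dualRange (T f) ⊆ dualRange f}

end FAlgebra

end

/-! Evaluation at `a` is an order continuous functional on `A^~`, and `f (a * b) = f (b * a)` for
every `f ∈ A^~`, because `(a, b) ↦ f (a * b)` is orthosymmetric when `f` is positive. Hence an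
`f`-linear `T` satisfies `T (f · a) = T f · a`. Moreover, a band projection `Q` of `A^~` commutes
with all the operators `f ↦ f · a`, since these are orthomorphisms, and the functionals
`f ↦ (Q f) a` are order continuous as well; `f`-linearity with respect to them shows that
`T ∘ Q - Q ∘ T` takes its values in the space `N` of all `u` with `u · a = 0` for all `a`. If `P`
is the band projection onto the disjoint complement of `N`, then `P ∘ T` commutes with every band
projection, so it is an orthomorphism and therefore order continuous. Every `g · a` is disjoint
from `N`, the kernel of a positive orthomorphism being disjoint from its range, so `P` fixes it.
Thus `F = G ∘ P ∘ T` is order continuous whenever `G` is, and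
`(F · f) a = G (P (T f · a)) = (G · T f) a`, i.e. `G · T f ∈ R(f)`. -/

/-- Dedekind completeness of an ordered set, as a property of the order alone. -/
class IsDedekindComplete (E : Type*) [Preorder E] : Prop where
  exists_isLUB : ∀ s : Set E, s.Nonempty → BddAbove s → ∃ u, IsLUB s u

/-- The Archimedean property of a partially ordered group used in Riesz space theory: the multiples
`n • x` are bounded above only if `x ≤ 0`. Mathlib's `Archimedean` is stronger: it fails for most
orders that are not linear. -/
class IsOrderArchimedean (E : Type*) [AddCommGroup E] [Preorder E] : Prop where
  nonpos_of_forall_nsmul_le : ∀ ⦃x y : E⦄, (∀ n : ℕ, n • x ≤ y) → x ≤ 0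

instance {E : Type*} [AddCommGroup E] [PartialOrder E] [IsOrderedAddMonoid E]
    [IsDedekindComplete E] : IsOrderArchimedean E where
  nonpos_of_forall_nsmul_le x y h := by
    obtain ⟨u, hu⟩ := IsDedekindComplete.exists_isLUB (Set.range fun n : ℕ => n • x)
      (Set.range_nonempty _) ⟨y, Set.forall_mem_range.2 h⟩
    have hux : u ≤ u - x := hu.2 <| Set.forall_mem_range.2 fun n =>
      le_sub_iff_add_le.2 (by simpa only [succ_nsmul] using hu.1 ⟨n + 1, rfl⟩)
    simpa using hux

instance {E : Type*} [AddCommGroup E] [LinearOrder E] [IsOrderedAddMonoid E] [Archimedean E] :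
    IsOrderArchimedean E where
  nonpos_of_forall_nsmul_le x y h := by
    by_contra! hx
    obtain ⟨n, hn⟩ := exists_lt_nsmul hx y
    exact (h n).not_gt hn

section LatticeGroup

theorem inf_eq_zero_mono {E : Type*} [Lattice E] [Zero E] {a b c d : E} (hc : 0 ≤ c) (hd : 0 ≤ d)
    (hca : c ≤ a) (hdb : d ≤ b) (h : a ⊓ b = 0) : c ⊓ d = 0 :=
  le_antisymm (h ▸ inf_le_inf hca hdb) (le_inf hc hd)

variable {E : Type*} [AddCommGroup E] [Lattice E] [IsOrderedAddMonoid E] {a b c d x y : E}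

theorem inf_add_le_of_nonneg (ha : 0 ≤ a) (hb : 0 ≤ b) (hc : 0 ≤ c) :
    a ⊓ (b + c) ≤ a ⊓ b + a ⊓ c := by
  rw [add_inf, inf_add, inf_add]
  refine le_inf (le_inf ?_ ?_) (le_inf ?_ inf_le_right)
  · exact inf_le_left.trans (le_add_of_nonneg_right ha)
  · exact inf_le_left.trans (le_add_of_nonneg_left hb)
  · exact inf_le_left.trans (le_add_of_nonneg_right hc)

theorem inf_add_eq_zero (hb : a ⊓ b = 0) (hc : a ⊓ c = 0) : a ⊓ (b + c) = 0 := by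
  have ha : 0 ≤ a := hb ▸ inf_le_left
  have hb0 : 0 ≤ b := hb ▸ inf_le_right
  have hc0 : 0 ≤ c := hc ▸ inf_le_right
  refine le_antisymm ?_ (le_inf ha (add_nonneg hb0 hc0))
  simpa [hb, hc] using inf_add_le_of_nonneg ha hb0 hc0

theorem inf_nsmul_eq_zero (h : a ⊓ b = 0) (n : ℕ) : a ⊓ (n • b) = 0 := by
  have ha : 0 ≤ a := h ▸ inf_le_left
  induction n with
  | zero => simpa using ha
  | succ n ih => exact succ_nsmul b n ▸ inf_add_eq_zero ih h

theorem nsmul_inf_eq_zero (h : a ⊓ b = 0) (n : ℕ) : (n • a) ⊓ b = 0 := by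
  rw [inf_comm] at h ⊢
  exact inf_nsmul_eq_zero h n

theorem le_of_le_add_of_inf_eq_zero (hb : 0 ≤ b) (hac : a ⊓ c = 0) (h : a ≤ b + c) : a ≤ b := by
  have ha : 0 ≤ a := hac ▸ inf_le_left
  have hc : 0 ≤ c := hac ▸ inf_le_right
  calc a = a ⊓ (b + c) := (inf_eq_left.2 h).symm
    _ ≤ a ⊓ b + a ⊓ c := inf_add_le_of_nonneg ha hb hc
    _ ≤ b := by rw [hac, add_zero]; exact inf_le_right

theorem abs_le_abs_add_of_inf_eq_zero (h : |x| ⊓ |y| = 0) : |x| ≤ |x + y| :=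
  le_of_le_add_of_inf_eq_zero (abs_nonneg _) h <| by
    simpa using abs_add_le (x + y) (-y)

theorem eq_zero_of_abs_inf_abs_self (h : |x| ⊓ |x| = 0) : x = 0 := by
  rw [inf_idem] at h
  exact le_antisymm (h ▸ le_abs_self x) (neg_nonpos.1 (h ▸ neg_le_abs x))

theorem inf_eq_zero_of_isLUB {s : Set E} {u : E} (hs : s.Nonempty) (hu : IsLUB s u)
    (h : ∀ x ∈ s, x ⊓ d = 0) : u ⊓ d = 0 := by
  obtain ⟨x₀, hx₀⟩ := hs
  have hd : 0 ≤ d := h x₀ hx₀ ▸ inf_le_right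
  have hu0 : 0 ≤ u := (h x₀ hx₀ ▸ inf_le_left : 0 ≤ x₀).trans (hu.1 hx₀)
  have hle : u ≤ u - u ⊓ d := hu.2 fun x hx => by
    have hxud : x ⊓ (u ⊓ d) = 0 :=
      inf_eq_zero_mono (h x hx ▸ inf_le_left) (le_inf hu0 hd) le_rfl inf_le_right (h x hx)
    rw [le_sub_iff_add_le, ← inf_add_sup x (u ⊓ d), hxud, zero_add]
    exact sup_le (hu.1 hx) inf_le_left
  exact le_antisymm (by simpa using hle) (le_inf hu0 hd)

theorem exists_eq_add_of_abs_le_add {u : E} (ha : 0 ≤ a) (hb : 0 ≤ b) (h : |u| ≤ a + b) :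
    ∃ v w, u = v + w ∧ |v| ≤ a ∧ |w| ≤ b := by
  obtain ⟨hu, hu'⟩ := abs_le'.1 h
  have hbb : -b ≤ b := (neg_nonpos.2 hb).trans hb
  refine ⟨u - (u ⊓ b ⊔ -b), u ⊓ b ⊔ -b, by abel, abs_le'.2 ⟨?_, ?_⟩, abs_le'.2 ⟨?_, ?_⟩⟩
  · calc u - (u ⊓ b ⊔ -b) ≤ u - u ⊓ b := sub_le_sub_left le_sup_left _
      _ = (u - b)⁺ := by rw [inf_eq_sub_posPart_sub]; abel
      _ ≤ a := sup_le (sub_le_iff_le_add.2 hu) ha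
  · rw [neg_sub, sub_le_iff_le_add]
    refine sup_le (inf_le_left.trans (le_add_of_nonneg_left ha)) ?_
    rwa [neg_le_iff_add_nonneg, add_right_comm, ← neg_le_iff_add_nonneg]
  · exact sup_le inf_le_right hbb
  · exact neg_le.1 le_sup_right

end LatticeGroup

section SublinearOrthomorphism

variable {E : Type*} [AddCommGroup E] [Lattice E]

/-- The properties of a positive orthomorphism that survive for the modulus of an order bounded
one: `p` is monotone, sublinear and band preserving on the positive cone. Its values elsewhere are
irrelevant. -/
structure IsSublinearOrthomorphism (p : E → E) : Prop where
  mono : ∀ ⦃x y⦄, 0 ≤ x → x ≤ y → p x ≤ p y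
  map_add_le : ∀ ⦃x y⦄, 0 ≤ x → 0 ≤ y → p (x + y) ≤ p x + p y
  nsmul_map_le : ∀ (n : ℕ) ⦃x⦄, 0 ≤ x → n • p x ≤ p (n • x)
  map_inf_eq_zero : ∀ ⦃x y⦄, x ⊓ y = 0 → p x ⊓ y = 0

namespace IsSublinearOrthomorphism

variable {p : E → E} {x k : E}

theorem map_nonneg (hp : IsSublinearOrthomorphism p) (hx : 0 ≤ x) : 0 ≤ p x :=
  hp.map_inf_eq_zero (inf_eq_right.2 hx) ▸ inf_le_left

theorem map_zero (hp : IsSublinearOrthomorphism p) : p 0 = 0 :=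
  (inf_idem (p 0)).symm.trans (hp.map_inf_eq_zero (inf_eq_left.2 (hp.map_nonneg le_rfl)))

variable [IsOrderedAddMonoid E]

theorem map_nsmul_le (hp : IsSublinearOrthomorphism p) (n : ℕ) (hx : 0 ≤ x) :
    p (n • x) ≤ n • p x := by
  induction n with
  | zero => simp [hp.map_zero]
  | succ n ih =>
    rw [succ_nsmul, succ_nsmul]
    exact (hp.map_add_le (nsmul_nonneg hx n) hx).trans (add_le_add_left ih _)

/-- With `v = (n • x - p x)⁺`, the part of `p x` exceeding `n • x` is disjoint from `v`, hence from
`p v`. -/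
theorem nsmul_map_le_map_map_add (hp : IsSublinearOrthomorphism p) (n : ℕ) (hx : 0 ≤ x) :
    n • p x ≤ p (p x) + n • n • x := by
  set d := n • x - p x
  have hnx : 0 ≤ n • x := nsmul_nonneg hx n
  have hpx : p x ≤ n • x + d⁻ := by
    simpa [d, add_comm] using neg_le_negPart d
  have hd : p d⁺ ≤ n • n • x := by
    refine le_of_le_add_of_inf_eq_zero (nsmul_nonneg hnx n)
      (inf_nsmul_eq_zero (hp.map_inf_eq_zero (posPart_inf_negPart_eq_zero d)) n) ?_
    calc p d⁺ ≤ p (n • x) :=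
          hp.mono (posPart_nonneg d) (sup_le (sub_le_self _ (hp.map_nonneg hx)) hnx)
      _ ≤ n • p x := hp.map_nsmul_le n hx
      _ ≤ n • (n • x + d⁻) := nsmul_le_nsmul_right hpx n
      _ = n • n • x + n • d⁻ := nsmul_add _ _ _
  calc n • p x ≤ p (n • x) := hp.nsmul_map_le n hx
    _ ≤ p (p x + d⁺) := hp.mono hnx (sub_le_iff_le_add'.1 (le_posPart d))
    _ ≤ p (p x) + p d⁺ := hp.map_add_le (hp.map_nonneg hx) (posPart_nonneg d)
    _ ≤ p (p x) + n • n • x := add_le_add_right hd _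

theorem map_inf_eq_zero_of_map_eq_zero [IsOrderArchimedean E] (hp : IsSublinearOrthomorphism p)
    (hx : 0 ≤ x) (hk : 0 ≤ k) (hpk : p k = 0) : p x ⊓ k = 0 := by
  have hw : 0 ≤ p x ⊓ k := le_inf (hp.map_nonneg hx) hk
  refine le_antisymm (IsOrderArchimedean.nonpos_of_forall_nsmul_le (y := x) fun n => ?_) hw
  set d := x - n • k
  have hpx : p x ≤ p d⁺ := calc
    p x ≤ p (d⁺ + n • k) := hp.mono hx (sub_le_iff_le_add.1 (le_posPart d))
    _ ≤ p d⁺ + p (n • k) := hp.map_add_le (posPart_nonneg d) (nsmul_nonneg hk n)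
    _ ≤ p d⁺ := by simpa [hpk] using hp.map_nsmul_le n hk
  have hdisj : p x ⊓ k ⊓ d⁻ = 0 := inf_eq_zero_mono hw (negPart_nonneg d) (inf_le_left.trans hpx)
    le_rfl (hp.map_inf_eq_zero (posPart_inf_negPart_eq_zero d))
  refine le_of_le_add_of_inf_eq_zero hx (nsmul_inf_eq_zero hdisj n) ?_
  calc n • (p x ⊓ k) ≤ n • k := nsmul_le_nsmul_right inf_le_right n
    _ ≤ x + d⁻ := by simpa [d, add_comm] using neg_le_negPart d

theorem isGLB_range_comp [Module ℝ E] [IsOrderedModule ℝ E] [IsOrderArchimedean E]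
    (hp : IsSublinearOrthomorphism p) {ι : Type*} [Preorder ι] [IsDirected ι (· ≤ ·)] [Nonempty ι]
    {y : ι → E} (hy : Antitone y) (hy0 : IsGLB (Set.range y) 0) :
    IsGLB (Set.range (p ∘ y)) 0 := by
  have hnonneg : ∀ i, 0 ≤ y i := fun i => hy0.1 ⟨i, rfl⟩
  refine ⟨Set.forall_mem_range.2 fun i => hp.map_nonneg (hnonneg i), fun c hc => ?_⟩
  obtain ⟨k⟩ := ‹Nonempty ι›
  refine IsOrderArchimedean.nonpos_of_forall_nsmul_le (y := p (p (y k))) fun n => ?_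
  rcases n.eq_zero_or_pos with rfl | hn
  · simpa using hp.map_nonneg (hp.map_nonneg (hnonneg k))
  have hn2 : (0 : ℝ) < (n * n : ℕ) := Nat.cast_pos.2 (Nat.mul_pos hn hn)
  have hle : ∀ j, n • c ≤ p (p (y k)) + n • n • y j := fun j => by
    obtain ⟨i, hki, hji⟩ := exists_ge_ge k j
    calc n • c ≤ n • p (y i) := nsmul_le_nsmul_right (hc ⟨i, rfl⟩) n
      _ ≤ p (p (y i)) + n • n • y i := hp.nsmul_map_le_map_map_add n (hnonneg i)
      _ ≤ p (p (y k)) + n • n • y j := add_le_add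
        (hp.mono (hp.map_nonneg (hnonneg i)) (hp.mono (hnonneg i) (hy hki)))
        (nsmul_le_nsmul_right (nsmul_le_nsmul_right (hy hji) n) n)
  have hscaled : ((n * n : ℕ) : ℝ)⁻¹ • (n • c - p (p (y k))) ≤ 0 :=
    hy0.2 <| Set.forall_mem_range.2 fun j => by
      rw [inv_smul_le_iff_of_pos hn2, Nat.cast_smul_eq_nsmul, mul_nsmul, sub_le_iff_le_add']
      exact hle j
  rwa [inv_smul_le_iff_of_pos hn2, smul_zero, sub_nonpos] at hscaled

end IsSublinearOrthomorphism

end SublinearOrthomorphism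

section BandPreserving

variable {E : Type*} [AddCommGroup E] [Lattice E]

/-- The defining property of orthomorphisms: `S` maps every element into the band it generates. -/
def IsBandPreserving (S : E → E) : Prop :=
  ∀ ⦃x y⦄, |x| ⊓ |y| = 0 → |S x| ⊓ |y| = 0

variable [IsOrderedAddMonoid E]

theorem abs_map_le_map_abs {F : Type*} [AddCommGroup F] [Lattice F] [IsOrderedAddMonoid F]
    {S : E →+ F} (hS : ∀ x, 0 ≤ x → 0 ≤ S x) (x : E) : |S x| ≤ S |x| := by
  refine abs_le'.2 ⟨?_, ?_⟩
  · simpa using hS _ (sub_nonneg.2 (le_abs_self x))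
  · simpa [neg_le_iff_add_nonneg] using hS _ (sub_nonneg.2 (neg_le_abs x))

theorem isBandPreserving_of_nonneg {S : E →+ E} (hS : ∀ x, 0 ≤ x → 0 ≤ S x)
    (hinf : ∀ x y, x ⊓ y = 0 → S x ⊓ y = 0) : IsBandPreserving S := fun x _ hxy =>
  inf_eq_zero_mono (abs_nonneg _) (abs_nonneg _) (abs_map_le_map_abs hS x) le_rfl (hinf _ _ hxy)

namespace IsBandPreserving

theorem sub {S T : E → E} (hS : IsBandPreserving S) (hT : IsBandPreserving T) :
    IsBandPreserving (S - T) := fun x y hxy => by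
  have hST := inf_add_eq_zero ((inf_comm _ _).trans (hS hxy)) ((inf_comm _ _).trans (hT hxy))
  rw [inf_comm] at hST
  refine inf_eq_zero_mono (abs_nonneg _) (abs_nonneg _) ?_ le_rfl hST
  simpa [sub_eq_add_neg] using abs_add_le (S x) (-T x)

theorem isSublinearOrthomorphism {S : E →+ E} (hb : IsBandPreserving S)
    (hS : ∀ x, 0 ≤ x → 0 ≤ S x) : IsSublinearOrthomorphism S where
  mono _ _ _ hxy := by simpa using hS _ (sub_nonneg.2 hxy)
  map_add_le x y _ _ := (map_add S x y).le
  nsmul_map_le n x _ := (map_nsmul S n x).ge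
  map_inf_eq_zero x y hxy := by
    have hx : 0 ≤ x := hxy ▸ inf_le_left
    have hy : 0 ≤ y := hxy ▸ inf_le_right
    have := @hb x y
    rw [abs_of_nonneg hx, abs_of_nonneg hy, abs_of_nonneg (hS x hx)] at this
    exact this hxy

/-- The kernel of a positive orthomorphism is disjoint from its range. -/
theorem abs_map_inf_abs_eq_zero [IsOrderArchimedean E] {S : E →+ E} (hb : IsBandPreserving S)
    (hS : ∀ x, 0 ≤ x → 0 ≤ S x) {k : E} (hk : S k = 0) (x : E) : |S x| ⊓ |k| = 0 := by
  have hp := hb.isSublinearOrthomorphism hS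
  have hpn : S k⁺ = S k⁻ := by rw [← sub_eq_zero, ← map_sub, posPart_sub_negPart, hk]
  have hdisj : S k⁺ ⊓ S k⁻ = 0 := by
    have := hp.map_inf_eq_zero (posPart_inf_negPart_eq_zero k)
    rw [inf_comm] at this ⊢
    exact hp.map_inf_eq_zero this
  have hk' : S |k| = 0 := by
    rw [hpn, inf_idem] at hdisj
    rw [← posPart_add_negPart k, map_add, hpn, hdisj, add_zero]
  exact inf_eq_zero_mono (abs_nonneg _) (abs_nonneg _) (abs_map_le_map_abs hS x) le_rfl
    (hp.map_inf_eq_zero_of_map_eq_zero (abs_nonneg x) (abs_nonneg k) hk')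

end IsBandPreserving

end BandPreserving

section AbsSmul

variable {E : Type*} [AddCommGroup E] [Module ℝ E] [Lattice E] [IsOrderedModule ℝ E]

theorem abs_smul_of_nonneg {t : ℝ} (ht : 0 ≤ t) (x : E) : |t • x| = t • |x| := by
  rcases ht.eq_or_lt with rfl | ht
  · simp only [zero_smul, abs, neg_zero, sup_idem]
  · simpa only [abs, OrderIso.smulRight_apply, smul_neg] using
      ((OrderIso.smulRight ht).map_sup x (-x)).symm

theorem abs_smul_eq_abs_smul_abs (t : ℝ) (x : E) : |t • x| = |t| • |x| := by
  rcases le_total 0 t with ht | ht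
  · rw [abs_smul_of_nonneg ht, abs_of_nonneg ht]
  · rw [abs_of_nonpos ht, ← abs_smul_of_nonneg (neg_nonneg.2 ht), neg_smul, abs_neg]

theorem abs_nsmul_eq_nsmul_abs (n : ℕ) (x : E) : |n • x| = n • |x| := by
  simpa only [Nat.cast_smul_eq_nsmul] using abs_smul_of_nonneg (Nat.cast_nonneg (α := ℝ) n) x

end AbsSmul

section Modulus

section Order

variable {E : Type*} [AddCommGroup E] [Lattice E]

/-- On the positive cone, `p` is given by the Riesz–Kantorovich formula for the modulus of `S`. Its
values elsewhere are irrelevant. -/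
def IsModulus (S p : E → E) : Prop :=
  ∀ ⦃a⦄, 0 ≤ a → IsLUB ((fun u => |S u|) '' {u | |u| ≤ a}) (p a)

theorem IsModulus.le_of_forall_abs_map_le {S p : E → E} (hp : IsModulus S p) {a c : E}
    (ha : 0 ≤ a) (h : ∀ u, |u| ≤ a → |S u| ≤ c) : p a ≤ c :=
  (hp ha).2 (Set.forall_mem_image.2 h)

theorem IsModulus.abs_map_le [IsOrderedAddMonoid E] {S p : E → E} (hp : IsModulus S p) {u a : E}
    (hu : |u| ≤ a) : |S u| ≤ p a :=
  (hp ((abs_nonneg u).trans hu)).1 ⟨u, hu, rfl⟩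

end Order

variable {E : Type*} [AddCommGroup E] [Module ℝ E] [Lattice E] [IsOrderedAddMonoid E]

theorem IsOrderBoundedMap.exists_isModulus [IsDedekindComplete E] {S : E →ₗ[ℝ] E}
    (hS : IsOrderBoundedMap S) : ∃ p, IsModulus S p := by
  have hlub : ∀ a : E, ∃ z, 0 ≤ a → IsLUB ((fun u => |S u|) '' {u | |u| ≤ a}) z := fun a => by
    by_cases ha : 0 ≤ a
    · obtain ⟨⟨l, hl⟩, m, hm⟩ := hS {u | |u| ≤ a}
        ⟨-a, fun u hu => neg_le.1 ((neg_le_abs u).trans hu)⟩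
        ⟨a, fun u hu => (le_abs_self u).trans hu⟩
      obtain ⟨z, hz⟩ := IsDedekindComplete.exists_isLUB ((fun u => |S u|) '' {u | |u| ≤ a})
        (.image _ ⟨0, by simpa using ha⟩)
        ⟨m ⊔ -l, Set.forall_mem_image.2 fun u hu =>
          sup_le_sup (hm ⟨u, hu, rfl⟩) (neg_le_neg (hl ⟨u, hu, rfl⟩))⟩
      exact ⟨z, fun _ => hz⟩
    · exact ⟨0, fun h => absurd h ha⟩
  exact ⟨_, fun a => (hlub a).choose_spec⟩

theorem IsModulus.isSublinearOrthomorphism [IsOrderedModule ℝ E] {S : E →ₗ[ℝ] E} {p : E → E}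
    (hp : IsModulus S p) (hS : IsBandPreserving S) : IsSublinearOrthomorphism p where
  mono x y hx hxy := hp.le_of_forall_abs_map_le hx fun u hu => hp.abs_map_le (hu.trans hxy)
  map_add_le x y hx hy := hp.le_of_forall_abs_map_le (add_nonneg hx hy) fun u hu => by
    obtain ⟨v, w, rfl, hv, hw⟩ := exists_eq_add_of_abs_le_add hx hy hu
    rw [map_add]
    exact (abs_add_le _ _).trans (add_le_add (hp.abs_map_le hv) (hp.abs_map_le hw))
  nsmul_map_le n x hx := by
    rcases n.eq_zero_or_pos with rfl | hn
    · simpa using (abs_nonneg _).trans (hp.abs_map_le (abs_zero (α := E)).le)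
    have hn' : (0 : ℝ) < n := Nat.cast_pos.2 hn
    rw [← Nat.cast_smul_eq_nsmul ℝ, ← le_inv_smul_iff_of_pos hn']
    refine hp.le_of_forall_abs_map_le hx fun u hu => ?_
    rw [le_inv_smul_iff_of_pos hn', Nat.cast_smul_eq_nsmul, ← abs_nsmul_eq_nsmul_abs, ← map_nsmul]
    exact hp.abs_map_le (abs_nsmul_eq_nsmul_abs n u ▸ nsmul_le_nsmul_right hu n)
  map_inf_eq_zero x y hxy := by
    have hx : 0 ≤ x := hxy ▸ inf_le_left
    have hy : 0 ≤ y := hxy ▸ inf_le_right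
    refine inf_eq_zero_of_isLUB (.image _ ⟨0, by simpa using hx⟩) (hp hx)
      (Set.forall_mem_image.2 fun u hu => ?_)
    have hu' : |S u| ⊓ |y| = 0 := hS <|
      inf_eq_zero_mono (abs_nonneg u) (abs_nonneg y) hu (abs_of_nonneg hy).le hxy
    rwa [abs_of_nonneg hy] at hu'

theorem OrderTendstoZero.map [IsOrderedModule ℝ E] [IsDedekindComplete E]
    {S : E →ₗ[ℝ] E} (hob : IsOrderBoundedMap S) (hbp : IsBandPreserving S) {ι : Type*} [Preorder ι]
    [IsDirected ι (· ≤ ·)] [Nonempty ι] {x : ι → E} (hx : OrderTendstoZero x) :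
    OrderTendstoZero (S ∘ x) := by
  obtain ⟨y, hy, hy0, hxy⟩ := hx
  obtain ⟨p, hp⟩ := hob.exists_isModulus
  have hps := hp.isSublinearOrthomorphism hbp
  exact ⟨p ∘ y, fun i j hij => hps.mono (hy0.1 ⟨j, rfl⟩) (hy hij), hps.isGLB_range_comp hy hy0,
    fun i => hp.abs_map_le (hxy i)⟩

end Modulus

section DisjointComplement

variable {E : Type*} [AddCommGroup E] [Module ℝ E] [Lattice E] [IsOrderedAddMonoid E]
  [IsOrderedModule ℝ E] {D : Set E} {x y : E}

theorem abs_smul_inf_eq_zero {b : E} (h : |x| ⊓ b = 0) (t : ℝ) : |t • x| ⊓ b = 0 := by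
  obtain ⟨n, hn⟩ := exists_nat_ge |t|
  have hle : |t • x| ≤ n • |x| := by
    rw [abs_smul_eq_abs_smul_abs, ← Nat.cast_smul_eq_nsmul ℝ]
    exact smul_le_smul_of_nonneg_right hn (abs_nonneg x)
  exact inf_eq_zero_mono (abs_nonneg _) (h ▸ inf_le_right) hle le_rfl (nsmul_inf_eq_zero h n)

/-- The disjoint complement `Dᵈ` of a set in a Riesz space. -/
def disjointCompl (D : Set E) : Submodule ℝ E where
  carrier := {x | ∀ d ∈ D, |x| ⊓ |d| = 0}
  zero_mem' := fun d _ => by simp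
  add_mem' {a b} ha hb d hd := by
    have hab : |d| ⊓ (|a| + |b|) = 0 :=
      inf_add_eq_zero ((inf_comm _ _).trans (ha d hd)) ((inf_comm _ _).trans (hb d hd))
    exact inf_eq_zero_mono (abs_nonneg _) (abs_nonneg _) (abs_add_le a b) le_rfl
      ((inf_comm _ _).trans hab)
  smul_mem' t _ ha d hd := abs_smul_inf_eq_zero (ha d hd) t

theorem mem_disjointCompl_singleton : x ∈ disjointCompl {y} ↔ |x| ⊓ |y| = 0 :=
  ⟨fun h => h y rfl, fun h _ hd => hd ▸ h⟩

theorem mem_disjointCompl_of_abs_le (hx : x ∈ disjointCompl D) (h : |y| ≤ |x|) :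
    y ∈ disjointCompl D := fun d hd =>
  inf_eq_zero_mono (abs_nonneg _) (abs_nonneg _) h le_rfl (hx d hd)

theorem subset_disjointCompl_disjointCompl (D : Set E) :
    D ⊆ disjointCompl (disjointCompl D : Set E) := fun _ hd _ hx =>
  (inf_comm _ _).trans (hx _ hd)

theorem IsBandPreserving.map_mem_disjointCompl {S : E → E} (hS : IsBandPreserving S)
    (hx : x ∈ disjointCompl D) : S x ∈ disjointCompl D := fun d hd => hS (hx d hd)

variable [IsDedekindComplete E]

theorem exists_add_eq_mem_disjointCompl (D : Set E) (hx : 0 ≤ x) :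
    ∃ u ∈ disjointCompl D, ∃ v ∈ disjointCompl (disjointCompl D : Set E), u + v = x := by
  set s : Set E := {u | u ∈ disjointCompl D ∧ 0 ≤ u ∧ u ≤ x}
  have hs : (0 : E) ∈ s := ⟨zero_mem _, le_rfl, hx⟩
  obtain ⟨u, hu⟩ := IsDedekindComplete.exists_isLUB s ⟨0, hs⟩ ⟨x, fun _ h => h.2.2⟩
  have hu0 : 0 ≤ u := hu.1 hs
  have hux : 0 ≤ x - u := sub_nonneg.2 (hu.2 fun _ h => h.2.2)
  have huD : u ∈ disjointCompl D := fun d hd => by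
    rw [abs_of_nonneg hu0]
    exact inf_eq_zero_of_isLUB ⟨0, hs⟩ hu fun w hw => abs_of_nonneg hw.2.1 ▸ hw.1 d hd
  refine ⟨u, huD, x - u, fun w hw => ?_, add_sub_cancel _ _⟩
  rw [abs_of_nonneg hux]
  have hv0 : 0 ≤ (x - u) ⊓ |w| := le_inf hux (abs_nonneg w)
  have hvD : (x - u) ⊓ |w| ∈ disjointCompl D :=
    mem_disjointCompl_of_abs_le hw ((abs_of_nonneg hv0).trans_le inf_le_right)
  have hle : u + (x - u) ⊓ |w| ≤ u := hu.1
    ⟨add_mem huD hvD, add_nonneg hu0 hv0, le_sub_iff_add_le'.1 inf_le_left⟩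
  exact le_antisymm (by simpa using hle) hv0

theorem isCompl_disjointCompl (D : Set E) :
    IsCompl (disjointCompl D) (disjointCompl (disjointCompl D : Set E)) := by
  refine ⟨Submodule.disjoint_def.2 fun _ hx hx' => eq_zero_of_abs_inf_abs_self (hx' _ hx), ?_⟩
  rw [codisjoint_iff, Submodule.eq_top_iff']
  have hpos : ∀ x : E, 0 ≤ x →
      x ∈ disjointCompl D ⊔ disjointCompl (disjointCompl D : Set E) := fun x hx =>
    Submodule.mem_sup.2 (exists_add_eq_mem_disjointCompl D hx)
  intro x
  rw [← posPart_sub_negPart x]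
  exact sub_mem (hpos _ (posPart_nonneg x)) (hpos _ (negPart_nonneg x))

/-- The band projection onto `Dᵈ`. -/
noncomputable def disjointProj (D : Set E) : E →ₗ[ℝ] E :=
  Submodule.projection _ _ (isCompl_disjointCompl D)

theorem disjointProj_mem (D : Set E) (x : E) : disjointProj D x ∈ disjointCompl D :=
  Submodule.projection_apply_mem _ x

theorem sub_disjointProj_mem (D : Set E) (x : E) :
    x - disjointProj D x ∈ disjointCompl (disjointCompl D : Set E) :=
  Submodule.sub_projection_mem _ x

theorem disjointProj_eq_self (hx : x ∈ disjointCompl D) : disjointProj D x = x :=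
  (Submodule.projection_eq_self_iff _ x).2 hx

theorem disjointProj_eq_zero (hx : x ∈ disjointCompl (disjointCompl D : Set E)) :
    disjointProj D x = 0 :=
  (Submodule.projection_apply_eq_zero_iff _).2 hx

theorem abs_disjointProj_inf_abs_sub (D : Set E) (x : E) :
    |disjointProj D x| ⊓ |x - disjointProj D x| = 0 :=
  (inf_comm _ _).trans (sub_disjointProj_mem D x _ (disjointProj_mem D x))

theorem abs_disjointProj_le (D : Set E) (x : E) : |disjointProj D x| ≤ |x| := by
  simpa using abs_le_abs_add_of_inf_eq_zero (abs_disjointProj_inf_abs_sub D x)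

theorem disjointProj_nonneg (D : Set E) (hx : 0 ≤ x) : 0 ≤ disjointProj D x := by
  have hle : |x - disjointProj D x| ≤ |x| := by
    simpa using abs_le_abs_add_of_inf_eq_zero
      ((inf_comm _ _).trans (abs_disjointProj_inf_abs_sub D x))
  rw [abs_of_nonneg hx] at hle
  simpa using (le_abs_self _).trans hle

theorem isOrderBoundedMap_disjointProj (D : Set E) : IsOrderBoundedMap (disjointProj D) :=
  RieszDual.isOrderBoundedMap_of_nonneg _ fun _ => disjointProj_nonneg D

theorem isBandPreserving_disjointProj (D : Set E) : IsBandPreserving (disjointProj D) :=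
  fun _ _ hxy => inf_eq_zero_mono (abs_nonneg _) (abs_nonneg _) (abs_disjointProj_le D _) le_rfl hxy

theorem IsBandPreserving.map_disjointProj {S : E →ₗ[ℝ] E} (hS : IsBandPreserving S) (D : Set E)
    (x : E) : S (disjointProj D x) = disjointProj D (S x) := by
  have hx : S x = S (disjointProj D x) + S (x - disjointProj D x) := by
    rw [← map_add, add_sub_cancel]
  rw [hx, map_add, disjointProj_eq_self (hS.map_mem_disjointCompl (disjointProj_mem D x)),
    disjointProj_eq_zero (hS.map_mem_disjointCompl (sub_disjointProj_mem D x)), add_zero]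

theorem isBandPreserving_of_map_disjointProj {S : E →ₗ[ℝ] E}
    (h : ∀ (D : Set E) (x : E), S (disjointProj D x) = disjointProj D (S x)) :
    IsBandPreserving S := fun x y hxy => by
  have hx : S x = disjointProj {y} (S x) := by
    rw [← h, disjointProj_eq_self (mem_disjointCompl_singleton.2 hxy)]
  rw [hx]
  exact mem_disjointCompl_singleton.1 (disjointProj_mem {y} (S x))

end DisjointComplement

section Orthosymmetric

variable {E F : Type*} [AddCommGroup E] [Lattice E] [AddCommGroup F] [PartialOrder F]

/-- Positive orthosymmetric biadditive maps. -/
structure IsOrthosymmetric (β : E →+ E →+ F) : Prop where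
  map_nonneg : ∀ ⦃x y⦄, 0 ≤ x → 0 ≤ y → 0 ≤ β x y
  map_eq_zero : ∀ ⦃x y⦄, x ⊓ y = 0 → β x y = 0

theorem IsOrthosymmetric.flip {β : E →+ E →+ F} (hβ : IsOrthosymmetric β) :
    IsOrthosymmetric β.flip where
  map_nonneg _ _ hx hy := hβ.map_nonneg hy hx
  map_eq_zero _ _ hxy := hβ.map_eq_zero ((inf_comm _ _).trans hxy)

/-- The slice of `x` between the heights `k • e` and `(k + 1) • e`. It lives where the preceding
slice already equals `e`, which is what orthosymmetric maps exploit. -/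
def layer (x e : E) (k : ℕ) : E := (x - k • e)⁺ ⊓ e

theorem layer_le (x e : E) (k : ℕ) : layer x e k ≤ e := inf_le_right

theorem layer_nonneg {e : E} (he : 0 ≤ e) (x : E) (k : ℕ) : 0 ≤ layer x e k :=
  le_inf (posPart_nonneg _) he

variable [IsOrderedAddMonoid E]

theorem posPart_posPart_sub {e : E} (he : 0 ≤ e) (y : E) : (y⁺ - e)⁺ = (y - e)⁺ := by
  rw [posPart_def (y⁺ - e), posPart_def y, sup_sub, zero_sub, sup_assoc,
    sup_eq_right.2 (neg_nonpos.2 he), posPart_def]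

theorem layer_eq_sub {e : E} (he : 0 ≤ e) (x : E) (k : ℕ) :
    layer x e k = (x - k • e)⁺ - (x - (k + 1) • e)⁺ := by
  rw [layer, inf_eq_sub_posPart_sub, posPart_posPart_sub he, succ_nsmul, sub_sub]

theorem sum_range_layer {x e : E} (hx : 0 ≤ x) (he : 0 ≤ e) {n : ℕ} (hxn : x ≤ n • e) :
    ∑ k ∈ Finset.range n, layer x e k = x := by
  simp only [layer_eq_sub he]
  rw [Finset.sum_range_sub' fun k => (x - k • e)⁺, posPart_of_nonpos (sub_nonpos.2 hxn), zero_nsmul,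
    sub_zero, sub_zero, posPart_of_nonneg hx]

theorem layer_succ_le {e : E} (he : 0 ≤ e) (x : E) (k : ℕ) : layer x e (k + 1) ≤ layer x e k :=
  inf_le_inf_right e <| posPart_mono <| sub_le_sub_left (nsmul_le_nsmul_left he k.le_succ) x

theorem layer_succ_inf_sub_layer {e : E} (he : 0 ≤ e) (x : E) (k : ℕ) :
    layer x e (k + 1) ⊓ (e - layer x e k) = 0 := by
  refine inf_eq_zero_mono (layer_nonneg he x _) (sub_nonneg.2 (layer_le x e k)) inf_le_left ?_
    (posPart_inf_negPart_eq_zero (x - (k + 1) • e))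
  calc e - layer x e k = (e - (x - k • e)⁺)⁺ := by
        rw [layer, inf_comm, inf_eq_sub_posPart_sub, sub_sub_cancel]
    _ ≤ (-(x - (k + 1) • e))⁺ := posPart_mono <| by
        rw [succ_nsmul, ← sub_sub, neg_sub]
        exact sub_le_sub_left (le_posPart _) e
    _ = (x - (k + 1) • e)⁻ := posPart_neg _

namespace IsOrthosymmetric

variable {β : E →+ E →+ F} {a b e x : E} [IsOrderedAddMonoid F]

theorem map_layer_sub_le (hβ : IsOrthosymmetric β) (he : 0 ≤ e) (x : E) (k : ℕ) :
    β (layer x e k) e - β e (layer x e k) ≤ β (layer x e k - layer x e (k + 1)) e := by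
  set c := layer x e k
  set d := layer x e (k + 1)
  have hc : 0 ≤ c := layer_nonneg he x k
  have hec : 0 ≤ e - c := sub_nonneg.2 (layer_le x e k)
  have hd : β d (e - c) = 0 := hβ.map_eq_zero (layer_succ_inf_sub_layer he x k)
  calc β c e - β e c = β (c - d) (e - c) - β (e - c) c := by
        rw [map_sub β c d, AddMonoidHom.sub_apply, hd, map_sub (β c), map_sub β e,
          AddMonoidHom.sub_apply]
        abel
    _ ≤ β (c - d) (e - c) := sub_le_self _ (hβ.map_nonneg hec hc)
    _ ≤ β (c - d) e := by
        rw [map_sub, sub_le_self_iff]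
        exact hβ.map_nonneg (sub_nonneg.2 (layer_succ_le he x k)) hc

theorem map_sub_map_le (hβ : IsOrthosymmetric β) (hx : 0 ≤ x) (he : 0 ≤ e) {n : ℕ}
    (hxn : x ≤ n • e) : β x e - β e x ≤ β e e := by
  set c := layer x e
  have hsum : ∑ k ∈ Finset.range n, c k = x := sum_range_layer hx he hxn
  calc β x e - β e x = ∑ k ∈ Finset.range n, (β (c k) e - β e (c k)) := by
        rw [Finset.sum_sub_distrib, ← map_sum, ← AddMonoidHom.finsetSum_apply, ← map_sum, hsum]
    _ ≤ ∑ k ∈ Finset.range n, β (c k - c (k + 1)) e :=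
        Finset.sum_le_sum fun k _ => hβ.map_layer_sub_le he x k
    _ = β (c 0 - c n) e := by
        rw [← AddMonoidHom.finsetSum_apply, ← map_sum, Finset.sum_range_sub']
    _ ≤ β e e := by
        rw [← sub_nonneg, ← AddMonoidHom.sub_apply, ← map_sub]
        refine hβ.map_nonneg (sub_nonneg.2 ?_) he
        exact (sub_le_self _ (layer_nonneg he x n)).trans (layer_le x e 0)

variable [IsOrderArchimedean F]

theorem map_le_map_swap_of_le (hβ : IsOrthosymmetric β) (ha : 0 ≤ a) (hae : a ≤ e) :
    β a e ≤ β e a := by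
  refine sub_nonpos.1 (IsOrderArchimedean.nonpos_of_forall_nsmul_le (y := β e e) fun n => ?_)
  have hle := hβ.map_sub_map_le (nsmul_nonneg ha n) (ha.trans hae) (nsmul_le_nsmul_right hae n)
  rwa [map_nsmul β, map_nsmul (β e), AddMonoidHom.nsmul_apply, ← nsmul_sub] at hle

theorem map_comm_of_nonneg (hβ : IsOrthosymmetric β) (ha : 0 ≤ a) (hb : 0 ≤ b) :
    β a b = β b a := by
  have hae : a ≤ a + b := le_add_of_nonneg_right hb
  have heq : β a (a + b) = β (a + b) a :=
    le_antisymm (hβ.map_le_map_swap_of_le ha hae) (hβ.flip.map_le_map_swap_of_le ha hae)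
  simpa using heq

theorem map_comm (hβ : IsOrthosymmetric β) (a b : E) : β a b = β b a := by
  rw [← posPart_sub_negPart a, ← posPart_sub_negPart b]
  simp only [map_sub, AddMonoidHom.sub_apply,
    hβ.map_comm_of_nonneg (posPart_nonneg b) (posPart_nonneg a),
    hβ.map_comm_of_nonneg (posPart_nonneg b) (negPart_nonneg a),
    hβ.map_comm_of_nonneg (negPart_nonneg b) (posPart_nonneg a),
    hβ.map_comm_of_nonneg (negPart_nonneg b) (negPart_nonneg a)]
  abel

end IsOrthosymmetric

end Orthosymmetric

namespace RieszDual

/-- Evaluation at a point, as a linear functional on the order dual. -/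
def evalLin {E : Type*} [AddCommGroup E] [Module ℝ E] [Preorder E] (x : E) :
    RieszDual E →ₗ[ℝ] ℝ where
  toFun f := f x
  map_add' _ _ := rfl
  map_smul' _ _ := rfl

section Bounds

variable {E : Type*} [AddCommGroup E] [Module ℝ E] [Lattice E] [IsOrderedAddMonoid E]

theorem apply_eq_posPart_sub_negPart (f : RieszDual E) (x : E) : f x = f x⁺ - f x⁻ := by
  rw [← map_sub, posPart_sub_negPart]

variable [IsOrderedModule ℝ E]

theorem abs_apply_le_of_nonneg (f : RieszDual E) {x : E} (hx : 0 ≤ x) : |f x| ≤ |f| x :=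
  abs_le'.2 ⟨le_abs_self f x hx, neg_le_abs f x hx⟩

theorem abs_apply_le (f : RieszDual E) (x : E) : |f x| ≤ |f| |x| := by
  rw [apply_eq_posPart_sub_negPart, ← posPart_add_negPart x, map_add]
  exact (abs_sub _ _).trans (add_le_add (abs_apply_le_of_nonneg f (posPart_nonneg x))
    (abs_apply_le_of_nonneg f (negPart_nonneg x)))

end Bounds

section MonotoneNet

variable {E : Type*} [AddCommGroup E] [Module ℝ E] [Lattice E] [IsOrderedAddMonoid E]
  {ι : Type*} [Preorder ι] {F : ι → RieszDual E}

theorem exists_tendsto_apply (hF : Monotone F) (hb : BddAbove (Set.range F)) (x : E) :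
    ∃ l, Tendsto (fun i => F i x) atTop (𝓝 l) := by
  obtain ⟨g, hg⟩ := hb
  have hpos : ∀ y : E, 0 ≤ y → ∃ l, Tendsto (fun i => F i y) atTop (𝓝 l) := fun y hy =>
    ⟨_, tendsto_atTop_ciSup (fun _ _ hij => hF hij y hy)
      ⟨g y, Set.forall_mem_range.2 fun i => hg ⟨i, rfl⟩ y hy⟩⟩
  obtain ⟨l, hl⟩ := hpos x⁺ (posPart_nonneg x)
  obtain ⟨m, hm⟩ := hpos x⁻ (negPart_nonneg x)
  exact ⟨l - m, (hl.sub hm).congr fun i => (apply_eq_posPart_sub_negPart (F i) x).symm⟩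

variable [IsDirected ι (· ≤ ·)] [Nonempty ι]

theorem isLUB_range_of_tendsto_apply (hF : Monotone F) {φ : RieszDual E}
    (hφ : ∀ x, Tendsto (fun i => F i x) atTop (𝓝 (φ x))) : IsLUB (Set.range F) φ :=
  ⟨Set.forall_mem_range.2 fun i x hx =>
    ge_of_tendsto (hφ x) (eventually_atTop.2 ⟨i, fun _ hij => hF hij x hx⟩),
    fun _ hψ x hx => le_of_tendsto (hφ x) (Eventually.of_forall fun i => hψ ⟨i, rfl⟩ x hx)⟩

variable [IsOrderedModule ℝ E]

theorem exists_forall_tendsto_apply (hF : Monotone F) (hb : BddAbove (Set.range F)) :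
    ∃ φ : RieszDual E, ∀ x, Tendsto (fun i => F i x) atTop (𝓝 (φ x)) := by
  choose l hl using exists_tendsto_apply hF hb
  let φ : E →ₗ[ℝ] ℝ := linearMapOfTendsto l (fun i => (F i).toLin) (tendsto_pi_nhds.2 hl)
  obtain ⟨k⟩ := ‹Nonempty ι›
  have hφk : IsOrderBoundedMap (φ - (F k).toLin) :=
    isOrderBoundedMap_of_nonneg _ fun x hx => sub_nonneg.2 <|
      ge_of_tendsto (hl x) (eventually_atTop.2 ⟨k, fun _ hkj => hF hkj x hx⟩)
  have hφ : IsOrderBoundedMap φ := by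
    have := (orderBoundedFunctionals E).add_mem hφk (F k).isOrderBoundedMap
    rwa [sub_add_cancel] at this
  exact ⟨ofLin φ hφ, hl⟩

theorem tendsto_apply_of_isLUB (hF : Monotone F) {φ : RieszDual E} (hφ : IsLUB (Set.range F) φ)
    (x : E) : Tendsto (fun i => F i x) atTop (𝓝 (φ x)) := by
  obtain ⟨ψ, hψ⟩ := exists_forall_tendsto_apply hF hφ.bddAbove
  rw [hφ.unique (isLUB_range_of_tendsto_apply hF hψ)]
  exact hψ x

theorem tendsto_apply_of_isGLB (hF : Antitone F) {φ : RieszDual E} (hφ : IsGLB (Set.range F) φ)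
    (x : E) : Tendsto (fun i => F i x) atTop (𝓝 (φ x)) := by
  have hneg : IsLUB (Set.range (-F)) (-φ) := by
    have hset : Set.range (-F) = -Set.range F := by
      ext f
      simp [neg_eq_iff_eq_neg]
    rw [hset, isLUB_neg, neg_neg]
    exact hφ
  simpa using (tendsto_apply_of_isLUB hF.neg hneg x).neg

end MonotoneNet

variable {E : Type*} [AddCommGroup E] [Module ℝ E] [Lattice E] [IsOrderedAddMonoid E]
  [IsOrderedModule ℝ E]

instance : IsDedekindComplete (RieszDual E) where
  exists_isLUB s hs hb := by
    have hne : Nonempty (supClosure s) := (hs.mono subset_supClosure).to_subtype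
    have hdir : IsDirected (supClosure s) (· ≤ ·) :=
      supClosed_supClosure.directedOn.isDirectedOrder
    have hmono : Monotone fun f : supClosure s => f.1 := fun _ _ h => h
    obtain ⟨φ, hφ⟩ := exists_forall_tendsto_apply hmono
      (by rwa [Subtype.range_coe, BddAbove, upperBounds_supClosure])
    have hlub := isLUB_range_of_tendsto_apply hmono hφ
    rw [Subtype.range_coe, isLUB_supClosure] at hlub
    exact ⟨φ, hlub⟩

/-- Evaluation at a point, as an element of the order bidual. -/
def eval (x : E) : RieszDual (RieszDual E) :=
  ofLin (evalLin x) <| by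
    have hpos : ∀ y : E, 0 ≤ y → IsOrderBoundedMap (evalLin y) := fun y hy =>
      isOrderBoundedMap_of_nonneg _ fun f hf => hf y hy
    have hx : evalLin x = evalLin x⁺ - evalLin x⁻ :=
      LinearMap.ext fun f => apply_eq_posPart_sub_negPart f x
    rw [hx]
    exact (hpos _ (posPart_nonneg x)).sub (hpos _ (negPart_nonneg x))

theorem eval_mem_orderContinuousDual (x : E) : eval x ∈ orderContinuousDual (RieszDual E) := by
  intro ι _ _ _ F ⟨y, hy, hy0, hF⟩
  refine squeeze_zero_norm (fun i => ?_) (tendsto_apply_of_isGLB hy hy0 |x|)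
  exact (abs_apply_le (F i) x).trans (hF i _ (abs_nonneg x))

end RieszDual

namespace RieszDual

section Adjoint

/-- The adjoint `S^~ : F^~ → E^~` of an order bounded operator. -/
def adjoint {E F : Type*} [AddCommGroup E] [Module ℝ E] [Preorder E] [AddCommGroup F] [Module ℝ F]
    [Preorder F] (S : E →ₗ[ℝ] F) (hS : IsOrderBoundedMap S) : RieszDual F →ₗ[ℝ] RieszDual E where
  toFun f := ofLin (f.toLin ∘ₗ S) (f.isOrderBoundedMap.comp hS)
  map_add' _ _ := rfl
  map_smul' _ _ := rfl

@[simp] theorem adjoint_apply {E F : Type*} [AddCommGroup E] [Module ℝ E] [Preorder E]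
    [AddCommGroup F] [Module ℝ F] [Preorder F] {S : E →ₗ[ℝ] F} (hS : IsOrderBoundedMap S)
    (f : RieszDual F) (x : E) : adjoint S hS f x = f (S x) := rfl

theorem nsmul_apply {E : Type*} [AddCommGroup E] [Module ℝ E] [Preorder E] (n : ℕ)
    (f : RieszDual E) (x : E) : (n • f) x = n • f x := by
  rw [← Nat.cast_smul_eq_nsmul ℝ, smul_apply, nsmul_eq_mul]

theorem adjoint_mem_orderContinuousDual {E : Type*} [AddCommGroup E] [Module ℝ E] [Lattice E]
    [IsOrderedAddMonoid E] [IsOrderedModule ℝ E] [IsDedekindComplete E] {S : E →ₗ[ℝ] E}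
    (hS : IsOrderBoundedMap S) (hb : IsBandPreserving S) {G : RieszDual E}
    (hG : G ∈ orderContinuousDual E) : adjoint S hS G ∈ orderContinuousDual E :=
  fun ι _ _ _ _ hx => hG ι _ (hx.map hS hb)

variable {E : Type*} [AddCommGroup E] [Module ℝ E] [Lattice E] [IsOrderedAddMonoid E]

theorem adjoint_nonneg {S : E →ₗ[ℝ] E} (hS : IsOrderBoundedMap S) (hpos : ∀ x, 0 ≤ x → 0 ≤ S x)
    {f : RieszDual E} (hf : 0 ≤ f) : 0 ≤ adjoint S hS f := fun x hx => hf _ (hpos x hx)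

theorem nsmul_adjoint_le {S : E →ₗ[ℝ] E} (hS : IsOrderBoundedMap S) (hb : IsBandPreserving S)
    (hpos : ∀ x, 0 ≤ x → 0 ≤ S x) {f : RieszDual E} (hf : 0 ≤ f) (n : ℕ) :
    n • adjoint S hS f ≤ adjoint S hS (adjoint S hS f) + n • n • f := fun x hx => by
  have hp : IsSublinearOrthomorphism S :=
    IsBandPreserving.isSublinearOrthomorphism (S := S.toAddMonoidHom) hb hpos
  have hle := hf _ (sub_nonneg.2 (hp.nsmul_map_le_map_map_add n hx))
  simpa [nsmul_apply] using hle

theorem isBandPreserving_adjoint [IsOrderedModule ℝ E] {S : E →ₗ[ℝ] E} (hS : IsOrderBoundedMap S)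
    (hb : IsBandPreserving S) (hpos : ∀ x, 0 ≤ x → 0 ≤ S x) :
    IsBandPreserving (adjoint S hS) := by
  refine isBandPreserving_of_nonneg (S := (adjoint S hS).toAddMonoidHom)
    (fun f => adjoint_nonneg hS hpos) fun f g hfg => ?_
  change adjoint S hS f ⊓ g = 0
  have hf : 0 ≤ f := hfg ▸ inf_le_left
  have hg : 0 ≤ g := hfg ▸ inf_le_right
  have hf' := adjoint_nonneg hS hpos hf
  have hh : 0 ≤ adjoint S hS f ⊓ g := le_inf hf' hg
  have hdisj : (adjoint S hS f ⊓ g) ⊓ f = 0 :=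
    inf_eq_zero_mono hh hf inf_le_right le_rfl ((inf_comm _ _).trans hfg)
  refine le_antisymm (IsOrderArchimedean.nonpos_of_forall_nsmul_le
    (y := adjoint S hS (adjoint S hS f)) fun n => ?_) hh
  refine le_of_le_add_of_inf_eq_zero (adjoint_nonneg hS hpos hf')
    (nsmul_inf_eq_zero (inf_nsmul_eq_zero (inf_nsmul_eq_zero hdisj n) n) n) ?_
  exact (nsmul_le_nsmul_right inf_le_left n).trans (nsmul_adjoint_le hS hb hpos hf n)

end Adjoint

end RieszDual

section FAlgebraDual

variable {A : Type*} [NonUnitalRing A] [Module ℝ A] [IsScalarTower ℝ A A] [SMulCommClass ℝ A A]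
  [Lattice A] [IsOrderedAddMonoid A] [IsOrderedModule ℝ A] [IsFAlgebra A]

namespace IsFAlgebra

theorem mul_eq_zero_of_inf_eq_zero {x y : A} (h : x ⊓ y = 0) : x * y = 0 := by
  have hxy : y ⊓ (x * y) = 0 := (inf_comm _ _).trans (mul_right_inf x y y h (h ▸ inf_le_right))
  simpa using mul_left_inf y (x * y) x hxy (h ▸ inf_le_left)

theorem isBandPreserving_mulLeft {a : A} (ha : 0 ≤ a) :
    IsBandPreserving (LinearMap.mulLeft ℝ a) :=
  isBandPreserving_of_nonneg (S := (LinearMap.mulLeft ℝ a).toAddMonoidHom)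
    (fun x hx => mul_nonneg a x ha hx) fun x y hxy => mul_left_inf x y a hxy ha

theorem isOrthosymmetric_apply_mul {f : RieszDual A} (hf : 0 ≤ f) :
    IsOrthosymmetric (AddMonoidHom.mul.compr₂ f.toLin.toAddMonoidHom : A →+ A →+ ℝ) where
  map_nonneg _ _ hx hy := hf _ (mul_nonneg _ _ hx hy)
  map_eq_zero _ _ hxy :=
    (congrArg f (mul_eq_zero_of_inf_eq_zero hxy)).trans (map_zero f.toLin)

theorem apply_mul_comm (f : RieszDual A) (a b : A) : f (a * b) = f (b * a) := by
  rw [← posPart_sub_negPart f]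
  exact congrArg₂ (· - ·) ((isOrthosymmetric_apply_mul (posPart_nonneg f)).map_comm a b)
    ((isOrthosymmetric_apply_mul (negPart_nonneg f)).map_comm a b)

end IsFAlgebra

theorem bidualMul_eval (a : A) (f : RieszDual A) :
    bidualMul (RieszDual.eval a) f = dualMul f a :=
  RieszDual.ext fun b => IsFAlgebra.apply_mul_comm f b a

/-- The operator `f ↦ f · a` on `A^~`. -/
def dualMulRight (a : A) : RieszDual A →ₗ[ℝ] RieszDual A :=
  RieszDual.adjoint (LinearMap.mulLeft ℝ a) (isOrderBoundedMap_mulLeft a)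

theorem dualMul_eq_sub (f : RieszDual A) (a : A) : dualMul f a = dualMul f a⁺ - dualMul f a⁻ := by
  change dualMulLin f a = dualMulLin f a⁺ - dualMulLin f a⁻
  rw [← map_sub, posPart_sub_negPart]

theorem dualMulRight_nonneg {a : A} (ha : 0 ≤ a) {f : RieszDual A} (hf : 0 ≤ f) :
    0 ≤ dualMulRight a f :=
  RieszDual.adjoint_nonneg _ (fun x hx => IsFAlgebra.mul_nonneg a x ha hx) hf

theorem isBandPreserving_dualMulRight_of_nonneg {a : A} (ha : 0 ≤ a) :
    IsBandPreserving (dualMulRight a) :=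
  RieszDual.isBandPreserving_adjoint _ (IsFAlgebra.isBandPreserving_mulLeft ha)
    fun x hx => IsFAlgebra.mul_nonneg a x ha hx

theorem isBandPreserving_dualMulRight (a : A) : IsBandPreserving (dualMulRight a) := by
  have ha : (dualMulRight a : RieszDual A → RieszDual A) = dualMulRight a⁺ - dualMulRight a⁻ :=
    funext fun f => dualMul_eq_sub f a
  rw [ha]
  exact (isBandPreserving_dualMulRight_of_nonneg (posPart_nonneg a)).sub
    (isBandPreserving_dualMulRight_of_nonneg (negPart_nonneg a))

theorem dualMul_disjointProj (D : Set (RieszDual A)) (f : RieszDual A) (a : A) :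
    dualMul (disjointProj D f) a = disjointProj D (dualMul f a) :=
  (isBandPreserving_dualMulRight a).map_disjointProj D f

theorem bidualMul_adjoint_disjointProj (D : Set (RieszDual A)) (F : RieszDual (RieszDual A))
    (f : RieszDual A) :
    bidualMul (RieszDual.adjoint (disjointProj D) (isOrderBoundedMap_disjointProj D) F) f =
      bidualMul F (disjointProj D f) :=
  RieszDual.ext fun a => congrArg F (dualMul_disjointProj D f a).symm

variable (A) in
/-- The functionals `u` with `u · a = 0` for all `a`, i.e. those vanishing on all products. -/
def nullFunctionals : Set (RieszDual A) := {u | ∀ a, dualMul u a = 0}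

theorem dualMul_mem_disjointCompl_nullFunctionals (f : RieszDual A) (a : A) :
    dualMul f a ∈ disjointCompl (nullFunctionals A) := by
  have hpos : ∀ b : A, 0 ≤ b → dualMul f b ∈ disjointCompl (nullFunctionals A) :=
    fun b hb u hu => IsBandPreserving.abs_map_inf_abs_eq_zero
      (S := (dualMulRight b).toAddMonoidHom) (isBandPreserving_dualMulRight_of_nonneg hb)
      (fun _ => dualMulRight_nonneg hb) (hu b) f
  rw [dualMul_eq_sub]
  exact sub_mem (hpos _ (posPart_nonneg a)) (hpos _ (negPart_nonneg a))

section FLinear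

variable {T : RieszDual A →ₗ[ℝ] RieszDual A}

theorem map_dualMul_of_mem_fLinearOperators (hT : T ∈ fLinearOperators A) (f : RieszDual A)
    (a : A) : T (dualMul f a) = dualMul (T f) a := by
  simpa only [bidualMul_eval] using hT.2 f _ (RieszDual.eval_mem_orderContinuousDual a)

theorem map_disjointProj_sub_mem_nullFunctionals (hT : T ∈ fLinearOperators A)
    (D : Set (RieszDual A)) (f : RieszDual A) :
    T (disjointProj D f) - disjointProj D (T f) ∈ nullFunctionals A := fun a => by
  have hF := hT.2 f _ (RieszDual.adjoint_mem_orderContinuousDual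
    (isOrderBoundedMap_disjointProj D) (isBandPreserving_disjointProj D)
    (RieszDual.eval_mem_orderContinuousDual a))
  simp only [bidualMul_adjoint_disjointProj, bidualMul_eval,
    map_dualMul_of_mem_fLinearOperators hT] at hF
  exact (map_sub (dualMulRight a) _ _).trans (sub_eq_zero.2 hF)

/-- Composing `T` with the projection that kills the null functionals discards the obstruction to
`T` commuting with band projections. -/
theorem isBandPreserving_disjointProj_nullFunctionals_comp (hT : T ∈ fLinearOperators A) :
    IsBandPreserving (disjointProj (nullFunctionals A) ∘ₗ T) :=
  isBandPreserving_of_map_disjointProj fun D f => by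
    have hnull := disjointProj_eq_zero (subset_disjointCompl_disjointCompl _
      (map_disjointProj_sub_mem_nullFunctionals hT D f))
    rw [map_sub, sub_eq_zero] at hnull
    exact hnull.trans ((isBandPreserving_disjointProj _).map_disjointProj D (T f))

theorem dualRange_map_subset (hT : T ∈ fLinearOperators A) (f : RieszDual A) :
    dualRange (T f) ⊆ dualRange f := by
  rintro _ ⟨G, hG, rfl⟩
  have hS := (isOrderBoundedMap_disjointProj (nullFunctionals A)).comp hT.1
  refine ⟨RieszDual.adjoint _ hS G, RieszDual.adjoint_mem_orderContinuousDual hS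
    (isBandPreserving_disjointProj_nullFunctionals_comp hT) hG, RieszDual.ext fun a => ?_⟩
  have hfix : disjointProj (nullFunctionals A) (T (dualMul f a)) = dualMul (T f) a := by
    rw [map_dualMul_of_mem_fLinearOperators hT,
      disjointProj_eq_self (dualMul_mem_disjointCompl_nullFunctionals _ _)]
  exact congrArg G hfix.symm

end FLinear

end FAlgebraDual

theorem theorem3p3_general (A : Type*) [NonUnitalRing A] [Module ℝ A] [IsScalarTower ℝ A A]
    [SMulCommClass ℝ A A] [Lattice A] [IsOrderedAddMonoid A] [IsOrderedModule ℝ A]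
    [IsFAlgebra A] : fLinearOperators A ⊆ fOrthomorphisms A :=
  fun _ hT => ⟨hT.1, dualRange_map_subset hT⟩

theorem theorem3p3 (A : Type*) [NonUnitalRing A] [Module ℝ A] [IsScalarTower ℝ A A]
    [SMulCommClass ℝ A A] [Lattice A] [IsOrderedAddMonoid A] [IsOrderedModule ℝ A]
    [IsFAlgebra A] (hA : HasSeparatingOrderDual A) :
    fLinearOperators A ⊆ fOrthomorphisms A :=
  theorem3p3_general A
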